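/- \textbf{Split trees.} Let $b\ge 1$, $s\ge 1$, $s_0,s_1\ge 0$ be integers with $s_0\le s$ and $bs_1\le s+1-s_0$, and let $\mathcal V=(V_1,\dots,V_b)$ be a random vector with $V_i\ge 0$, $\sum_i V_i=1$ and identically distributed components; $V$ denotes a random variable with the law of the $V_i$. Give every vertex $v$ of the infinite rooted $b$-ary tree $S_b$ an independent copy $\mathcal V_v$ of $\mathcal V$. Initially there are no balls. Let $C_v$ be the number of balls held by $v$, and $n_v$ the number of balls in the subtree rooted at $v$. The split tree $T^n$ is obtained by adding $n$ balls, one by one, to the subtree rooted at the root, where a ball is added to the subtree rooted at $v$ as follows. (1) If $C_v\ne n_v$, choose a child of $v$ at random with probabilities $\mathcal V_v$ and add the ball to the subtree rooted at that child. (2) If $C_v=n_v<s$, put the ball at $v$. (3) If $C_v=n_v=s$, then $v$ keeps $s_0$ randomly chosen balls of its now $s+1$ balls, $s_1$ of them are given to each of its $b$ children, and each of the remaining $s+1-s_0-bs_1$ balls is added to the subtree rooted at a child chosen independently with probabilities $\mathcal V_v$. The vertices of $T^n$ are the $v\in S_b$ with $n_v>0$ at the end; $d(v)$ is the depth of $v$.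 \textbf{Assumptions.} $\mathbf P(V=1)=\mathbf P(V=0)=0$, and $-\ln V$ is non-lattice (not concentrated on $\{md: m\in\mathbb Z\}$ for any $d>0$). Put $$\mu:=b\,\mathbf E(-V\ln V)=\mathbf E\Big(-\sum_i V_i\ln V_i\Big).$$ \textbf{Theorem.} Let $\varepsilon>0$. Call a vertex $v$ of $T^n$ bad if it does not satisfy $$\mu^{-1}\ln n-\ln^{0.5+\varepsilon}n\le d(v)\le \mu^{-1}\ln n+\ln^{0.5+\varepsilon}n .$$ Then for every constant $k\in\mathbb R$ there is a constant $C$ such that for all $n\ge 2$ the expected number of bad vertices of $T^n$ is at most $C\,n/\ln^k n$. If moreover $\varepsilon\le\frac12$, then there are constants $B>0$ and $C$ such that for all $n\ge2$ the expected number of bad vertices of $T^n$ is at most $C\,n\exp(-B\ln^{2\varepsilon}n)$. The constants depend only on the law of $\mathcal V$, on $b,s,s_0,s_1$, on $\varepsilon$ and (in the first bound) on $k$. -/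

import Mathlib

open MeasureTheory
open scoped ENNReal

namespace SplitTree

/-- The vertices of the skeleton tree `S_b`: the vertex reached from the root by going to child
`i₁`, then to its child `i₂`, …, then to child `i_d` is the list `[i_d, …, i₂, i₁]`. Thus `[]` is
the root, `i :: v` is the `i`-th child of `v`, and the depth of `v` is `v.length`. -/
abbrev Vertex (b : ℕ) : Type := List (Fin b)

/-- A state of the split tree generating algorithm.
* `held v` is `C_v`, the number of balls held by `v` itself;
* `total v` is `n_v`, the number of balls that have been sent into the subtree rooted at `v`;
* `used v` is the number of random choices of a child made at `v` so far;
* `pending` is the stack of recursive calls still to be carried out: an entry `v` is a call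
  "add a ball to the subtree rooted at `v`". -/
structure State (b : ℕ) where
  held : Vertex b → ℕ
  total : Vertex b → ℕ
  used : Vertex b → ℕ
  pending : List (Vertex b)

/-- One step of the algorithm with vertex capacity `s` and parameters `s₀`, `s₁`; it carries out the
topmost pending call "add a ball to the subtree rooted at `v`". The `k`-th random choice of a child
made at `v` has the outcome `choice v k`.

A vertex with `C_v = n_v` is a leaf or is still empty. If it holds fewer than `s` balls, it takes
the ball. If it is full, it splits: it keeps `s₀` of its `s + 1` balls, each of its `b` children is
given `s₁` of them, and then each of the remaining `s + 1 - s₀ - b s₁` balls is sent to a randomly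
chosen child. A vertex that is not a leaf passes the ball on to a randomly chosen child.
(Which of the balls stay at a splitting vertex does not influence the numbers of balls.) -/
def step {b : ℕ} (s s₀ s₁ : ℕ) (choice : Vertex b → ℕ → Fin b) (σ : State b) : State b :=
  match σ.pending with
  | [] => σ
  | v :: rest =>
    if σ.held v = σ.total v then
      if σ.total v < s then
        { held := Function.update σ.held v (σ.held v + 1)
          total := Function.update σ.total v (σ.total v + 1)
          used := σ.used
          pending := rest }
      else
        { held := Function.update σ.held v s₀
          total := Function.update σ.total v (σ.total v + 1)
          used := Function.update σ.used v (σ.used v + (s + 1 - s₀ - b * s₁))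
          pending :=
            (List.finRange b).flatMap (fun i => List.replicate s₁ (i :: v)) ++
              (List.range (s + 1 - s₀ - b * s₁)).map (fun j => choice v (σ.used v + j) :: v) ++
              rest }
    else
      { held := σ.held
        total := Function.update σ.total v (σ.total v + 1)
        used := Function.update σ.used v (σ.used v + 1)
        pending := (choice v (σ.used v) :: v) :: rest }

/-- The initial state: no vertex holds a ball, and `n` balls are to be added to the root, one after
the other (the recursive calls caused by a ball are put on top of the stack, so they are finished
before the next ball is added). -/
def start (b n : ℕ) : State b where
  held := fun _ => 0
  total := fun _ => 0
  used := fun _ => 0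
  pending := List.replicate n []

/-- The vertex set of the split tree with `n` balls: the vertices with `n_v > 0` when the algorithm
has finished. (No `n_v` ever decreases, and the state does not change any more once the stack is
empty, so "at some time" is the same as "in the final state".) -/
def vertices {b : ℕ} (s s₀ s₁ n : ℕ) (choice : Vertex b → ℕ → Fin b) : Set (Vertex b) :=
  {v | ∃ m : ℕ, 0 < ((step s s₀ s₁ choice)^[m] (start b n)).total v}

/-- The child selected by a number `u ∈ [0, 1)` according to the probability vector `w`: the
smallest `i` with `u < w₀ + ⋯ + wᵢ`. For `u` uniform on `[0, 1]` it equals `i` with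
probability `wᵢ`. -/
noncomputable def pickChild {b : ℕ} [NeZero b] (w : Fin b → ℝ) (u : ℝ) : Fin b :=
  open Classical in
  if h : ∃ i : Fin b, u < ∑ j ∈ Finset.Iic i, w j then Fin.find _ h else 0

/-- The sample space: each vertex has a split vector and a sequence of numbers in `[0, 1]`, from
which its random choices are made. -/
abbrev Sample (b : ℕ) : Type := Vertex b → (Fin b → ℝ) × (ℕ → unitInterval)

/-- The split vectors `𝒱_v` are independent with law `ν`, and independent of them there are
independent uniform random variables on `[0, 1]`. -/
noncomputable def sampleLaw {b : ℕ} (ν : Measure (Fin b → ℝ)) [IsProbabilityMeasure ν] :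
    Measure (Sample b) :=
  Measure.infinitePi fun _ : Vertex b =>
    ν.prod (Measure.infinitePi fun _ : ℕ => (volume : Measure unitInterval))

/-- The `k`-th choice of a child at `v`. Given the split vectors, all these choices are
independent, and child `i` of `v` is chosen with probability the `i`-th component of `𝒱_v`. -/
noncomputable def choices {b : ℕ} [NeZero b] (ω : Sample b) (v : Vertex b) (k : ℕ) : Fin b :=
  pickChild (ω v).1 ((ω v).2 k)

/-- `ν` is the law of a split vector `(V_1, …, V_b)`: a random probability vector whose components
are identically distributed. -/
structure IsSplitVectorLaw {b : ℕ} (ν : Measure (Fin b → ℝ)) : Prop where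
  nonneg : ∀ᵐ w ∂ν, ∀ i, 0 ≤ w i
  sum_eq_one : ∀ᵐ w ∂ν, ∑ i, w i = 1
  identDistrib : ∀ i j, ν.map (fun w => w i) = ν.map (fun w => w j)

/-- The law of a real random variable is non-lattice: it is not concentrated on the integer
multiples of any `d > 0`. -/
def NonLattice (ρ : Measure ℝ) : Prop :=
  ∀ d : ℝ, 0 < d → ¬ ∀ᵐ x ∂ρ, ∃ m : ℤ, x = m * d

/-- `μ = E(-ln Δ)`, where `Δ = V_j` with probability `V_j` given `(V_1, …, V_b)`; that is,
`μ = E(∑ j, -V_j ln V_j) = b E(-V ln V)`. -/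
noncomputable def mu {b : ℕ} (ν : Measure (Fin b → ℝ)) : ℝ :=
  ∫ w, ∑ j, w j * -Real.log (w j) ∂ν

/-- A depth `d` is good if `μ⁻¹ ln n - ln^{0.5+ε} n ≤ d ≤ μ⁻¹ ln n + ln^{0.5+ε} n`. -/
def GoodDepth (μ ε : ℝ) (n d : ℕ) : Prop :=
  μ⁻¹ * Real.log n - Real.log n ^ (0.5 + ε : ℝ) ≤ d ∧
    d ≤ μ⁻¹ * Real.log n + Real.log n ^ (0.5 + ε : ℝ)

/-- The bad vertices of the split tree with `n` balls. -/
def badVertices {b : ℕ} (μ ε : ℝ) (s s₀ s₁ n : ℕ) (choice : Vertex b → ℕ → Fin b) :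
    Set (Vertex b) :=
  {v ∈ vertices s s₀ s₁ n choice | ¬ GoodDepth μ ε n v.length}

/-- The expected number of bad vertices of the random split tree with `n` balls. -/
noncomputable def expectedBad {b : ℕ} [NeZero b] (ν : Measure (Fin b → ℝ))
    [IsProbabilityMeasure ν] (ε : ℝ) (s s₀ s₁ n : ℕ) : ℝ≥0∞ :=
  ∫⁻ ω, ((badVertices (mu ν) ε s s₀ s₁ n (choices ω)).encard : ℝ≥0∞) ∂(sampleLaw ν)

end SplitTree

namespace SplitTree

/-! The final ball counts satisfy a top-down recursion: a vertex with `m > s` balls sends child `i`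
the `s₁` gifts plus a binomial number of balls, given its split vector. `vertices_subset` reduces
the algorithm to this recursion, and the rest is a first-moment Chernoff bound at each depth.

Apart from the gifts, the second factorial moment of a child's count is at most `w i ^ 2` times that
of its parent (`lintegral_pairs_le`). Interpolating between this moment and a constant through a
free scale `y` gives, for `0 ≤ θ ≤ 2`, at most `2 n ^ θ (E ∑ V_i ^ θ) ^ D` expected vertices at
depth `D` with at least `s₁ + 2` balls (`iterate_childrenSum_le`). Every vertex at depth at least
two has such a grandparent, so `expectedLevel_le` follows. Second moments matter because the deep
levels need `θ > 1`.

Near `θ = 1`, `E ∑ V_i ^ (1 + t) ≤ exp (-tμ + 16bt²)` (`moment_le`). With `l = log n` and distance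
at least `r l` from `l / μ`, taking `t = ∓ c r` gains a factor `exp (-c μ r² l / 2)` on either side.
For `r = min (l ^ (ε - 1/2)) 1` the gain is exponential in `min (l ^ (2ε)) l`, and part of it pays
for summing over depths (`exists_expectedBad_le`). -/

/-! ### From the algorithm to a recursion for ball counts -/

/-- The number of balls that a vertex holding `m` balls in its subtree sends to its child `i`, if
its choices of children are `c`. -/
def childCount {b : ℕ} (s s₀ s₁ : ℕ) (c : ℕ → Fin b) (i : Fin b) (m : ℕ) : ℕ :=
  if m ≤ s then 0
  else s₁ + ((Finset.range (m - s₀ - b * s₁)).filter fun k => c k = i).card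

/-- The final number of balls in the subtree rooted at a vertex of the split tree. -/
def ballCount {b : ℕ} (s s₀ s₁ n : ℕ) (choice : Vertex b → ℕ → Fin b) : Vertex b → ℕ
  | [] => n
  | i :: v => childCount s s₀ s₁ (choice v) i (ballCount s s₀ s₁ n choice v)

lemma childCount_mono {b : ℕ} (s s₀ s₁ : ℕ) (c : ℕ → Fin b) (i : Fin b) :
    Monotone (childCount s s₀ s₁ c i) := by
  intro m m' h
  unfold childCount
  split_ifs with h1 h2
  · exact le_rfl
  · exact Nat.zero_le _
  · omega
  · refine Nat.add_le_add_left (Finset.card_le_card (Finset.filter_subset_filter _ ?_)) _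
    exact Finset.range_subset_range.2 (by omega)

/-- The bookkeeping identities preserved by the algorithm. -/
structure Invariant {b : ℕ} (s s₀ s₁ n : ℕ) (choice : Vertex b → ℕ → Fin b) (σ : State b) :
    Prop where
  held : ∀ v, σ.held v = if σ.total v ≤ s then σ.total v else s₀
  used : ∀ v, σ.used v = if σ.total v ≤ s then 0 else σ.total v - s₀ - b * s₁
  root : σ.total [] + σ.pending.count [] = n
  child : ∀ i v, σ.total (i :: v) + σ.pending.count (i :: v) =
    childCount s s₀ s₁ (choice v) i (σ.total v)

lemma Invariant.start {b : ℕ} (s s₀ s₁ n : ℕ) (choice : Vertex b → ℕ → Fin b) :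
    Invariant s s₀ s₁ n choice (start b n) where
  held v := by simp [SplitTree.start]
  used v := by simp [SplitTree.start]
  root := by simp [SplitTree.start]
  child i v := by simp [SplitTree.start, childCount, List.count_replicate]

lemma count_gifts {b : ℕ} (s₁ : ℕ) (v u : Vertex b) (i : Fin b) :
    ((List.finRange b).flatMap (fun i => List.replicate s₁ (i :: v))).count (i :: u) =
      if u = v then s₁ else 0 := by
  rw [List.count_flatMap]
  have : (List.count (i :: u) ∘ fun j : Fin b => List.replicate s₁ (j :: v)) =
      fun j => if i = j then (if u = v then s₁ else 0) else 0 := by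
    ext j
    have hj : (j :: v = i :: u) = (i = j ∧ u = v) := by
      rw [List.cons.injEq, @eq_comm _ j, @eq_comm _ v]
    simp only [Function.comp_apply, List.count_replicate, beq_iff_eq, hj, ite_and]
  rw [this, ← List.ofFn_eq_map, List.sum_ofFn]
  simp

lemma count_choices {b : ℕ} (c : ℕ → Fin b) (r : ℕ) (v u : Vertex b) (i : Fin b) :
    ((List.range r).map (fun j => c j :: v)).count (i :: u) =
      if u = v then ((Finset.range r).filter fun k => c k = i).card else 0 := by
  induction r with
  | zero => simp
  | succ r ih =>
    rw [List.range_succ, List.map_append, List.count_append, ih, Finset.range_add_one,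
      Finset.filter_insert]
    have hj : (c r :: v = i :: u) = (u = v ∧ c r = i) := by
      rw [List.cons.injEq, @eq_comm _ v, and_comm]
    simp only [List.map_cons, List.map_nil, List.count_singleton, beq_iff_eq, hj, ite_and]
    by_cases h : u = v <;> by_cases h' : c r = i <;> simp [h, h']

lemma count_nil_gifts {b : ℕ} (s₁ : ℕ) (v : Vertex b) :
    ((List.finRange b).flatMap (fun i => List.replicate s₁ (i :: v))).count [] = 0 := by
  rw [List.count_eq_zero]
  simp

lemma count_nil_choices {b : ℕ} (c : ℕ → Fin b) (r : ℕ) (v : Vertex b) :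
    ((List.range r).map (fun j => c j :: v)).count [] = 0 := by
  rw [List.count_eq_zero]
  simp

/-- A call taken off the stack becomes a ball counted at its vertex, so total plus pending is
unchanged there. At a split, `childCount` jumps from zero by exactly the gifts and choices pushed
onto the stack; later each ball passed on consumes the next unused choice. -/
lemma Invariant.step {b : ℕ} {s s₀ s₁ n : ℕ} (hs₀ : s₀ ≤ s) (hs₁ : b * s₁ ≤ s + 1 - s₀)
    {choice : Vertex b → ℕ → Fin b} {σ : State b} (h : Invariant s s₀ s₁ n choice σ) :
    Invariant s s₀ s₁ n choice (SplitTree.step s s₀ s₁ choice σ) := by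
  obtain ⟨held, total, used, pending⟩ := σ
  obtain ⟨h1, h2, h3, h4⟩ := h
  simp only at h1 h2 h3 h4
  unfold SplitTree.step
  cases pending with
  | nil => exact ⟨h1, h2, h3, h4⟩
  | cons v rest =>
    have hv1 := h1 v
    have hv2 := h2 v
    have hne : ∀ i : Fin b, i :: v ≠ v := fun i => List.cons_ne_self i v
    simp only
    split_ifs with ha hb
    · refine ⟨fun u => ?_, fun u => ?_, ?_, fun i u => ?_⟩
      · by_cases hu : u = v
        · subst hu
          simp only [Function.update_self]
          rw [if_pos (by omega)]; omega
        · simpa [Function.update_of_ne hu] using h1 u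
      · by_cases hu : u = v
        · subst hu
          simp only [Function.update_self]
          rw [if_pos (by omega)]
          rw [if_pos (by omega)] at hv2; exact hv2
        · simpa [Function.update_of_ne hu] using h2 u
      · by_cases hu : v = []
        · subst hu
          simp only [Function.update_self]
          simp at h3; omega
        · simp only [Function.update_of_ne (Ne.symm hu)]
          simpa [List.count_cons, hu] using h3
      · have h5 := h4 i u
        have e1 : childCount s s₀ s₁ (choice u) i (Function.update total v (total v + 1) u) =
            childCount s s₀ s₁ (choice u) i (total u) := by
          by_cases hu : u = v
          · subst hu
            simp only [Function.update_self, childCount]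
            rw [if_pos (by omega), if_pos (by omega)]
          · rw [Function.update_of_ne hu]
        simp only [e1, ← h5]
        by_cases hu : i :: u = v
        · subst hu
          simp; omega
        · rw [Function.update_of_ne hu, List.count_cons_of_ne (Ne.symm hu)]
    -- If the total exceeded `s`, the vertex would hold `s₀ ≤ s` balls, contradicting equality of
    -- held and total. So this is a leaf at exact capacity.
    · have ht : total v = s := by
        split_ifs at hv1 <;> omega
      refine ⟨fun u => ?_, fun u => ?_, ?_, fun i u => ?_⟩
      · by_cases hu : u = v
        · subst hu
          simp only [Function.update_self]
          rw [if_neg (by omega)]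
        · simpa [Function.update_of_ne hu] using h1 u
      · by_cases hu : u = v
        · subst hu
          simp only [Function.update_self]
          rw [if_neg (by omega)]
          rw [if_pos (by omega)] at hv2; omega
        · simpa [Function.update_of_ne hu] using h2 u
      · simp only [List.count_append, count_nil_gifts, count_nil_choices]
        by_cases hu : v = []
        · subst hu
          simp only [Function.update_self]
          simp at h3; omega
        · simp only [Function.update_of_ne (Ne.symm hu)]
          simpa [List.count_cons, hu] using h3
      · have h5 := h4 i u
        simp only [List.count_append, count_gifts, count_choices]
        by_cases hu : u = v
        · subst hu
          rw [if_pos (by omega)] at hv2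
          rw [Function.update_of_ne (hne i), Function.update_self]
          rw [List.count_cons_of_ne (Ne.symm (hne i))] at h5
          simp only [childCount] at h5 ⊢
          rw [if_pos (by omega)] at h5
          rw [ht, hv2, if_neg (Nat.not_succ_le_self s)]
          simp only [if_true, Nat.zero_add]
          omega
        · simp only [if_neg hu, Function.update_of_ne hu, ← h5]
          by_cases hu' : i :: u = v
          · subst hu'
            simp; omega
          · rw [Function.update_of_ne hu', List.count_cons_of_ne (Ne.symm hu')]
            omega
    · have ht : s < total v := by
        by_contra hc
        rw [if_pos (by omega)] at hv1; exact ha hv1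
      rw [if_neg (by omega)] at hv2
      refine ⟨fun u => ?_, fun u => ?_, ?_, fun i u => ?_⟩
      · by_cases hu : u = v
        · subst hu
          simp only [Function.update_self]
          rw [if_neg (by omega)]
          rw [if_neg (by omega)] at hv1; exact hv1
        · simpa [Function.update_of_ne hu] using h1 u
      · by_cases hu : u = v
        · subst hu
          simp only [Function.update_self]
          rw [if_neg (by omega)]
          omega
        · simpa [Function.update_of_ne hu] using h2 u
      · by_cases hu : v = []
        · subst hu
          simp only [Function.update_self]
          simp at h3 ⊢; omega
        · simp only [Function.update_of_ne (Ne.symm hu)]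
          simpa [List.count_cons, hu] using h3
      · have h5 := h4 i u
        by_cases hu : u = v
        · subst hu
          simp only [Function.update_of_ne (hne i), Function.update_self]
          rw [List.count_cons_of_ne (Ne.symm (hne i))] at h5
          simp only [childCount] at h5 ⊢
          rw [if_neg (by omega)] at h5 ⊢
          have e : total u + 1 - s₀ - b * s₁ = (total u - s₀ - b * s₁) + 1 := by omega
          rw [e, Finset.range_add_one, Finset.filter_insert, ← hv2]
          rw [← hv2] at h5
          by_cases hc : choice u (used u) = i
          · simp [hc]; omega
          · simp [hc]; omega
        · simp only [Function.update_of_ne hu, ← h5]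
          have hc : choice v (used v) :: v ≠ i :: u := by
            intro h; exact hu (List.cons.inj h).2.symm
          rw [List.count_cons_of_ne hc]
          by_cases hu' : i :: u = v
          · subst hu'
            simp; omega
          · rw [Function.update_of_ne hu', List.count_cons_of_ne (Ne.symm hu')]

/-- Dropping the pending calls only decreases counts, and `childCount` is monotone in the parent's
count. The bound holds at every time, so termination of the algorithm is not needed. -/
lemma Invariant.total_le {b : ℕ} {s s₀ s₁ n : ℕ} {choice : Vertex b → ℕ → Fin b} {σ : State b}
    (h : Invariant s s₀ s₁ n choice σ) (v : Vertex b) :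
    σ.total v ≤ ballCount s s₀ s₁ n choice v := by
  induction v with
  | nil => exact (Nat.le_add_right _ _).trans h.root.le
  | cons i v ih =>
    exact ((Nat.le_add_right _ _).trans (h.child i v).le).trans (childCount_mono _ _ _ _ _ ih)

lemma vertices_subset {b : ℕ} {s s₀ s₁ : ℕ} (hs₀ : s₀ ≤ s) (hs₁ : b * s₁ ≤ s + 1 - s₀) (n : ℕ)
    (choice : Vertex b → ℕ → Fin b) :
    vertices s s₀ s₁ n choice ⊆ {v | 0 < ballCount s s₀ s₁ n choice v} := by
  rintro v ⟨m, hm⟩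
  have : Invariant s s₀ s₁ n choice ((SplitTree.step s s₀ s₁ choice)^[m] (SplitTree.start b n)) := by
    clear hm
    induction m with
    | zero => exact Invariant.start ..
    | succ m ih => rw [Function.iterate_succ_apply']; exact ih.step hs₀ hs₁
  exact hm.trans_le (this.total_le v)

/-- A vertex with a nonempty grandchild has at least `s₁ + 2` balls in its subtree. -/
lemma two_le_of_grandchild_pos {b : ℕ} (hb : 2 ≤ b) {s s₀ s₁ n : ℕ} (hs : 0 < s)
    (hs₁ : b * s₁ ≤ s + 1 - s₀)
    {choice : Vertex b → ℕ → Fin b} {i j : Fin b} {v : Vertex b}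
    (h : 0 < ballCount s s₀ s₁ n choice (i :: j :: v)) :
    2 ≤ ballCount s s₀ s₁ n choice v - s₁ := by
  set m := ballCount s s₀ s₁ n choice v with hm
  have h1 : s < ballCount s s₀ s₁ n choice (j :: v) := by
    by_contra hc
    rw [ballCount, childCount, if_pos (not_lt.1 hc)] at h
    exact h.false
  simp only [ballCount, childCount, ← hm] at h1
  split_ifs at h1 with h2
  · omega
  have h3 := (Finset.card_filter_le (Finset.range (m - s₀ - b * s₁)) fun k => choice v k = j)
  rw [Finset.card_range] at h3
  have h4 : 2 * s₁ ≤ b * s₁ := Nat.mul_le_mul_right _ hb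
  generalize b * s₁ = q at *
  omega

/-! ### Choosing a child, and factorial moments of one child's count -/

lemma pickChild_eq_iff {b : ℕ} [NeZero b] (w : Fin b → ℝ) (u : ℝ) (i : Fin b) :
    pickChild w u = i ↔ (u < ∑ j ∈ Finset.Iic i, w j ∧ ∀ l < i, ¬ u < ∑ j ∈ Finset.Iic l, w j) ∨
      (i = 0 ∧ ∀ l, ¬ u < ∑ j ∈ Finset.Iic l, w j) := by
  classical
  unfold pickChild
  split_ifs with h
  · rw [Fin.find_eq_iff]
    constructor
    · exact fun h' => Or.inl h'
    · rintro (h' | h')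
      · exact h'
      · obtain ⟨l, hl⟩ := h
        exact absurd hl (h'.2 l)
  · push Not at h
    constructor
    · rintro rfl
      exact Or.inr ⟨rfl, fun l => not_lt.2 (h l)⟩
    · rintro (h' | h')
      · exact absurd h'.1 (not_lt.2 (h i))
      · exact h'.1.symm

lemma measurable_pickChild {b : ℕ} [NeZero b] :
    Measurable fun p : (Fin b → ℝ) × ℝ => pickChild p.1 p.2 := by
  have hlt : ∀ i : Fin b, MeasurableSet
      {p : (Fin b → ℝ) × ℝ | p.2 < ∑ j ∈ Finset.Iic i, p.1 j} := fun i =>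
    measurableSet_lt measurable_snd
      (Finset.measurable_sum _ fun j _ => (measurable_pi_apply j).comp measurable_fst)
  refine measurable_to_countable' fun i => ?_
  have : (fun p : (Fin b → ℝ) × ℝ => pickChild p.1 p.2) ⁻¹' {i} =
      ({p | p.2 < ∑ j ∈ Finset.Iic i, p.1 j} ∩
        ⋂ l, ⋂ (_ : l < i), {p | p.2 < ∑ j ∈ Finset.Iic l, p.1 j}ᶜ) ∪
      ({_p | i = 0} ∩ ⋂ l, {p | p.2 < ∑ j ∈ Finset.Iic l, p.1 j}ᶜ) := by
    ext p
    simp [pickChild_eq_iff]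
  rw [this]
  exact ((hlt i).inter (.iInter fun l => .iInter fun _ => (hlt l).compl)).union
    ((MeasurableSet.const _).inter (.iInter fun l => (hlt l).compl))

lemma volume_pickChild_le {b : ℕ} [NeZero b] {w : Fin b → ℝ} (h0 : ∀ i, 0 ≤ w i)
    (h1 : ∑ i, w i = 1) (i : Fin b) :
    volume {u : unitInterval | pickChild w u = i} ≤ ENNReal.ofReal (w i) := by
  rw [unitInterval.volume_apply]
  -- The choice `i` occupies an interval of length `w i`; the default child `0` can occur only at `u
  -- = 1`, a null set.
  have hsub : (Subtype.val '' {u : unitInterval | pickChild w u = i}) ⊆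
      Set.Ico (∑ j ∈ Finset.Iio i, w j) (∑ j ∈ Finset.Iio i, w j + w i) ∪ {1} := by
    rintro _ ⟨u, hu, rfl⟩
    rcases (pickChild_eq_iff w u i).1 hu with ⟨hu1, hu2⟩ | ⟨-, hu2⟩
    · left
      constructor
      · rcases (Finset.Iio i).eq_empty_or_nonempty with he | he
        · rw [he, Finset.sum_empty]; exact u.2.1
        · have hm := Finset.max'_mem _ he
          refine le_trans ?_ (not_lt.1 (hu2 _ (Finset.mem_Iio.1 hm)))
          exact Finset.sum_le_sum_of_subset_of_nonneg
            (fun j hj => Finset.mem_Iic.2 (Finset.le_max' _ j hj)) fun j _ _ => h0 j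
      · rwa [← Finset.Iio_insert, Finset.sum_insert (by simp), add_comm] at hu1
    · right
      have := hu2 ⊤
      rw [Finset.Iic_top, h1, not_lt] at this
      exact le_antisymm u.2.2 this
  refine (measure_mono hsub).trans ((measure_union_le _ _).trans ?_)
  simp

/-- The law of the random data attached to one vertex. -/
noncomputable abbrev vertexLaw {b : ℕ} (ν : Measure (Fin b → ℝ)) :
    Measure ((Fin b → ℝ) × (ℕ → unitInterval)) :=
  ν.prod (Measure.infinitePi fun _ : ℕ => (volume : Measure unitInterval))

/-- The number of balls sent to child `i` by a vertex with random data `x` and `m` balls. -/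
noncomputable def randomChildCount {b : ℕ} [NeZero b] (s s₀ s₁ : ℕ) (i : Fin b) (m : ℕ)
    (x : (Fin b → ℝ) × (ℕ → unitInterval)) : ℕ :=
  childCount s s₀ s₁ (fun k => pickChild x.1 (x.2 k)) i m

lemma measurable_randomChildCount {b : ℕ} [NeZero b] (s s₀ s₁ : ℕ) (i : Fin b) (m : ℕ) :
    Measurable (randomChildCount s s₀ s₁ i m) := by
  unfold randomChildCount childCount
  split_ifs
  · exact measurable_const
  · simp only [Finset.card_filter]
    refine measurable_const.add (Finset.measurable_sum _ fun k _ => Measurable.ite ?_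
      measurable_const measurable_const)
    have : Measurable fun x : (Fin b → ℝ) × (ℕ → unitInterval) =>
        pickChild x.1 (x.2 k : ℝ) :=
      measurable_pickChild.comp (measurable_fst.prodMk
        (measurable_subtype_coe.comp ((measurable_pi_apply k).comp measurable_snd)))
    exact this (measurableSet_singleton i)

/-- The second factorial moment of the number of choices of child `i` among `N` choices. -/
lemma lintegral_card_mul_card_sub_one_le {b : ℕ} [NeZero b] {w : Fin b → ℝ} (h0 : ∀ i, 0 ≤ w i)
    (h1 : ∑ i, w i = 1) (i : Fin b) (N : ℕ) :
    ∫⁻ u : ℕ → unitInterval,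
      (((((Finset.range N).filter fun k => pickChild w (u k) = i).card) *
        (((Finset.range N).filter fun k => pickChild w (u k) = i).card - 1) : ℕ) : ℝ≥0∞)
      ∂(Measure.infinitePi fun _ : ℕ => (volume : Measure unitInterval)) ≤
    ENNReal.ofReal (w i) ^ 2 * ((N * (N - 1) : ℕ) : ℝ≥0∞) := by
  set A : Set unitInterval := {u | pickChild w u = i} with hA
  have hAm : MeasurableSet A :=
    (measurable_pickChild.comp (measurable_const.prodMk measurable_subtype_coe))
      (measurableSet_singleton i)
  -- `X (X - 1)` counts ordered pairs of distinct successful trials; independence bounds each pair's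
  -- probability by `w i ^ 2`.
  have hoff : ∀ S : Finset ℕ, S.card * (S.card - 1) = S.offDiag.card := fun S => by
    rw [Finset.offDiag_card, Nat.mul_sub_one]
  have key : ∀ u : ℕ → unitInterval,
      (((((Finset.range N).filter fun k => pickChild w (u k) = i).card) *
        (((Finset.range N).filter fun k => pickChild w (u k) = i).card - 1) : ℕ) : ℝ≥0∞) =
      ∑ q ∈ (Finset.range N).offDiag,
        ({u : ℕ → unitInterval | u q.1 ∈ A ∧ u q.2 ∈ A}.indicator 1 u : ℝ≥0∞) := by
    intro u
    rw [hoff]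
    have : ((Finset.range N).filter fun k => pickChild w (u k) = i).offDiag =
        (Finset.range N).offDiag.filter fun q => u q.1 ∈ A ∧ u q.2 ∈ A := by
      ext q
      simp only [Finset.mem_offDiag, Finset.mem_filter, hA, Set.mem_ofPred_eq]
      tauto
    classical
    rw [this, Finset.card_filter]
    push_cast
    refine Finset.sum_congr rfl fun q _ => ?_
    simp only [Set.indicator_apply, Set.mem_ofPred_eq, Pi.one_apply]
  have hm : ∀ q : ℕ × ℕ, MeasurableSet {u : ℕ → unitInterval | u q.1 ∈ A ∧ u q.2 ∈ A} := fun q =>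
    (hAm.preimage (measurable_pi_apply q.1)).inter (hAm.preimage (measurable_pi_apply q.2))
  simp_rw [key]
  rw [lintegral_finsetSum _ fun q _ => measurable_one.indicator (hm q)]
  calc _ ≤ ∑ q ∈ (Finset.range N).offDiag, ENNReal.ofReal (w i) ^ 2 := by
        refine Finset.sum_le_sum fun q hq => ?_
        rw [lintegral_indicator_one (hm q)]
        have hne : q.1 ≠ q.2 := (Finset.mem_offDiag.1 hq).2.2
        have e := Measure.infinitePi_map_eval_prod
          (P := fun _ : ℕ => (volume : Measure unitInterval)) hne
        have e2 : {u : ℕ → unitInterval | u q.1 ∈ A ∧ u q.2 ∈ A} =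
            (fun u : ℕ → unitInterval => (u q.1, u q.2)) ⁻¹' (A ×ˢ A) := rfl
        rw [e2, ← Measure.map_apply (by fun_prop) (hAm.prod hAm), e, Measure.prod_prod, sq]
        exact mul_le_mul' (volume_pickChild_le h0 h1 i) (volume_pickChild_le h0 h1 i)
    _ = _ := by
        rw [Finset.sum_const, ← hoff, Finset.card_range, nsmul_eq_mul, mul_comm]

/-- The falling factorial `(m - s₁) (m - s₁ - 1)`. -/
def pairs (s₁ m : ℕ) : ℕ := (m - s₁) * (m - s₁ - 1)

/-- Subtracting `s₁` removes the gifts and leaves a count over `m - s₀ - b * s₁ ≤ m - s₁` trials.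
The factorial moment therefore contracts by `w i ^ 2` with no lower-order term. -/
lemma lintegral_pairs_le {b : ℕ} [NeZero b] (s s₀ s₁ : ℕ) {w : Fin b → ℝ} (h0 : ∀ i, 0 ≤ w i)
    (h1 : ∑ i, w i = 1) (i : Fin b) (m : ℕ) :
    ∫⁻ u : ℕ → unitInterval, (pairs s₁ (randomChildCount s s₀ s₁ i m (w, u)) : ℝ≥0∞)
      ∂(Measure.infinitePi fun _ : ℕ => (volume : Measure unitInterval)) ≤
    ENNReal.ofReal (w i) ^ 2 * (pairs s₁ m : ℝ≥0∞) := by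
  unfold randomChildCount childCount
  split_ifs with hms
  · simp [pairs]
  · simp only [pairs, Nat.add_sub_cancel_left]
    refine (lintegral_card_mul_card_sub_one_le h0 h1 i _).trans ?_
    have hb : 1 * s₁ ≤ b * s₁ := Nat.mul_le_mul_right _ (Nat.pos_of_ne_zero (NeZero.ne b))
    gcongr <;> omega

/-! ### The one-generation operator and its iterates -/

/-- The expected sum of `g` over the children of a vertex with `m` balls. -/
noncomputable def childrenSum {b : ℕ} [NeZero b] (ν : Measure (Fin b → ℝ)) (s s₀ s₁ : ℕ)
    (g : ℕ → ℝ≥0∞) (m : ℕ) : ℝ≥0∞ :=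
  ∑ i : Fin b, ∫⁻ x, g (randomChildCount s s₀ s₁ i m x) ∂(vertexLaw ν)

/-- The moment `E ∑ i, V_i ^ θ`. -/
noncomputable def moment {b : ℕ} (ν : Measure (Fin b → ℝ)) (θ : ℝ) : ℝ≥0∞ :=
  ∑ i : Fin b, ∫⁻ w, ENNReal.ofReal (w i ^ θ) ∂ν

/-- Since the hypothesis holds for every scale, it can be applied at child `i` with the random scale
`y * w i`. Both terms then acquire the same factor `w i ^ θ`, which averages to `moment ν θ`. -/
lemma childrenSum_le {b : ℕ} [NeZero b] {ν : Measure (Fin b → ℝ)} [IsProbabilityMeasure ν]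
    (h_pos : ∀ᵐ w ∂ν, ∀ i, 0 < w i) (h_sum : ∀ᵐ w ∂ν, ∑ i, w i = 1) (s s₀ s₁ : ℕ) (θ : ℝ)
    {g : ℕ → ℝ≥0∞} {K : ℝ≥0∞}
    (hg : ∀ m, ∀ y : ℝ, 0 < y →
      g m ≤ K * (pairs s₁ m * ENNReal.ofReal (y ^ (θ - 2)) + ENNReal.ofReal (y ^ θ)))
    (m : ℕ) {y : ℝ} (hy : 0 < y) :
    childrenSum ν s s₀ s₁ g m ≤ moment ν θ * K *
      (pairs s₁ m * ENNReal.ofReal (y ^ (θ - 2)) + ENNReal.ofReal (y ^ θ)) := by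
  unfold childrenSum moment
  rw [mul_assoc, Finset.sum_mul]
  refine Finset.sum_le_sum fun i _ => ?_
  have hmeas : ∀ f : ℕ → ℝ≥0∞, Measurable fun x => f (randomChildCount s s₀ s₁ i m x) := fun f =>
    (measurable_from_top (f := f)).comp (measurable_randomChildCount s s₀ s₁ i m)
  rw [lintegral_prod _ (hmeas g).aemeasurable]
  rw [← lintegral_mul_const _ (by fun_prop)]
  refine lintegral_mono_ae ?_
  filter_upwards [h_pos, h_sum] with w hw hw1
  have hwi := hw i
  have hyw : 0 < y * w i := mul_pos hy hwi
  calc _ ≤ ∫⁻ u, K * (pairs s₁ (randomChildCount s s₀ s₁ i m (w, u)) *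
          ENNReal.ofReal ((y * w i) ^ (θ - 2)) + ENNReal.ofReal ((y * w i) ^ θ))
          ∂(Measure.infinitePi fun _ : ℕ => (volume : Measure unitInterval)) :=
        lintegral_mono fun u => hg _ _ hyw
    _ = K * ((∫⁻ u, (pairs s₁ (randomChildCount s s₀ s₁ i m (w, u)) : ℝ≥0∞)
          ∂(Measure.infinitePi fun _ : ℕ => (volume : Measure unitInterval))) *
          ENNReal.ofReal ((y * w i) ^ (θ - 2)) + ENNReal.ofReal ((y * w i) ^ θ)) := by
        have h1 : Measurable fun u : ℕ → unitInterval =>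
            (pairs s₁ (randomChildCount s s₀ s₁ i m (w, u)) : ℝ≥0∞) :=
          (hmeas fun k => (pairs s₁ k : ℝ≥0∞)).comp (by fun_prop : Measurable (Prod.mk w))
        rw [lintegral_const_mul _ ((h1.mul_const _).add_const _),
          lintegral_add_right _ measurable_const, lintegral_mul_const _ h1, lintegral_const,
          measure_univ, mul_one]
    _ ≤ K * ((ENNReal.ofReal (w i) ^ 2 * (pairs s₁ m : ℝ≥0∞)) *
          ENNReal.ofReal ((y * w i) ^ (θ - 2)) + ENNReal.ofReal ((y * w i) ^ θ)) := by
        gcongr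
        exact lintegral_pairs_le s s₀ s₁ (fun j => (hw j).le) hw1 i m
    _ = _ := by
        have e1 : ENNReal.ofReal (w i) ^ 2 * ENNReal.ofReal ((y * w i) ^ (θ - 2)) =
            ENNReal.ofReal (w i ^ θ) * ENNReal.ofReal (y ^ (θ - 2)) := by
          rw [← ENNReal.ofReal_pow hwi.le, ← ENNReal.ofReal_mul (by positivity),
            ← ENNReal.ofReal_mul (by positivity), Real.mul_rpow hy.le hwi.le,
            Real.rpow_sub hwi, Real.rpow_two]
          congr 1
          field_simp
        have e2 : ENNReal.ofReal ((y * w i) ^ θ) =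
            ENNReal.ofReal (w i ^ θ) * ENNReal.ofReal (y ^ θ) := by
          rw [← ENNReal.ofReal_mul (by positivity), Real.mul_rpow hy.le hwi.le, mul_comm]
        rw [mul_right_comm, e1, e2]
        ring

lemma iterate_childrenSum_le {b : ℕ} [NeZero b] {ν : Measure (Fin b → ℝ)} [IsProbabilityMeasure ν]
    (h_pos : ∀ᵐ w ∂ν, ∀ i, 0 < w i) (h_sum : ∀ᵐ w ∂ν, ∑ i, w i = 1) (s s₀ s₁ : ℕ) {θ : ℝ}
    (hθ0 : 0 ≤ θ) (hθ2 : θ ≤ 2) (D m : ℕ) {y : ℝ} (hy : 0 < y) :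
    (childrenSum ν s s₀ s₁)^[D] (fun m => if 2 ≤ m - s₁ then 1 else 0) m ≤ moment ν θ ^ D *
      (pairs s₁ m * ENNReal.ofReal (y ^ (θ - 2)) + ENNReal.ofReal (y ^ θ)) := by
  induction D generalizing m y with
  | zero =>
    simp only [Function.iterate_zero, id_eq, pow_zero, one_mul]
    split_ifs with h
    -- The second term is at least one when `y ≥ 1`, the first when `y ≤ 1`; this is where `0 ≤ θ ≤
    -- 2` enters.
    · rcases le_total 1 y with h1 | h1
      · refine le_trans ?_ le_add_self
        rw [ENNReal.one_le_ofReal]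
        exact Real.one_le_rpow h1 hθ0
      · refine le_trans ?_ le_self_add
        have h2 : (1 : ℝ≥0∞) ≤ ENNReal.ofReal (y ^ (θ - 2)) := by
          rw [ENNReal.one_le_ofReal]
          exact Real.one_le_rpow_of_pos_of_le_one_of_nonpos hy h1 (by linarith)
        have h3 : (1 : ℝ≥0∞) ≤ pairs s₁ m := by
          exact_mod_cast Nat.mul_pos (show 0 < m - s₁ by omega) (show 0 < m - s₁ - 1 by omega)
        exact one_le_mul h3 h2
    · exact zero_le
  | succ D ih =>
    rw [Function.iterate_succ_apply', pow_succ']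
    exact childrenSum_le h_pos h_sum s s₀ s₁ θ (fun m y hy => ih m hy) m hy

/-! ### Independence across generations and expected level sizes -/

instance {b : ℕ} (ν : Measure (Fin b → ℝ)) [IsProbabilityMeasure ν] :
    IsProbabilityMeasure (sampleLaw ν) := by
  unfold sampleLaw
  infer_instance

lemma ballCount_congr {b : ℕ} (s s₀ s₁ n : ℕ) {c c' : Vertex b → ℕ → Fin b} (v : Vertex b)
    (h : ∀ u : Vertex b, u.length < v.length → c u = c' u) :
    ballCount s s₀ s₁ n c v = ballCount s s₀ s₁ n c' v := by
  induction v with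
  | nil => rfl
  | cons i v ih =>
    rw [ballCount, ballCount, h v (by simp), ih fun u hu => h u (hu.trans (by simp))]

lemma measurable_ballCount {b : ℕ} [NeZero b] (s s₀ s₁ n : ℕ) (v : Vertex b) :
    Measurable fun ω : Sample b => ballCount s s₀ s₁ n (choices ω) v := by
  induction v with
  | nil => exact measurable_const
  | cons i v ih =>
    have h : Measurable fun p : ℕ × ((Fin b → ℝ) × (ℕ → unitInterval)) =>
        randomChildCount s s₀ s₁ i p.1 p.2 :=
      measurable_from_prod_countable_right fun m => measurable_randomChildCount s s₀ s₁ i m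
    exact h.comp (ih.prodMk (measurable_pi_apply v))

/-- The data at a vertex are independent of the number of balls it receives. -/
lemma map_ballCount_prodMk {b : ℕ} [NeZero b] (ν : Measure (Fin b → ℝ)) [IsProbabilityMeasure ν]
    (s s₀ s₁ n : ℕ) (v : Vertex b) :
    (sampleLaw ν).map (fun ω => (ballCount s s₀ s₁ n (choices ω) v, ω v)) =
      ((sampleLaw ν).map fun ω => ballCount s s₀ s₁ n (choices ω) v).prod (vertexLaw ν) := by
  classical
  have hind : ProbabilityTheory.iIndepFun (fun (u : Vertex b) (ω : Sample b) => ω u)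
      (sampleLaw ν) :=
    ProbabilityTheory.iIndepFun_infinitePi
      (P := fun _ : Vertex b => vertexLaw ν) (X := fun _ x => x) fun _ => measurable_id
  -- The count at `v` depends only on data at strictly smaller depths, a finite set not containing
  -- `v`.
  set S : Finset (Vertex b) := (List.finite_length_lt (Fin b) v.length).toFinset with hS
  have hdisj : Disjoint S {v} := by simp [hS]
  have h1 := hind.indepFun_finset S {v} hdisj fun u => measurable_pi_apply u
  -- An arbitrary filler outside `S`; the count at `v` never reads it.
  let x₀ : (Fin b → ℝ) × (ℕ → unitInterval) := (0, 0)
  let ext : (S → (Fin b → ℝ) × (ℕ → unitInterval)) → Sample b := fun z u =>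
    if h : u ∈ S then z ⟨u, h⟩ else x₀
  have hext : Measurable ext := by
    refine measurable_pi_lambda _ fun u => ?_
    by_cases h : u ∈ S
    · simpa only [ext, h, dite_true] using measurable_pi_apply _
    · simpa only [ext, h, dite_false] using measurable_const
  have h2 := h1.comp ((measurable_ballCount s s₀ s₁ n v).comp hext)
    (measurable_pi_apply (⟨v, by simp⟩ : ({v} : Finset (Vertex b))))
  have e : ((fun ω => ballCount s s₀ s₁ n (choices ω) v) ∘ ext) ∘
      (fun (a : Sample b) (i : S) => a i) = fun ω => ballCount s s₀ s₁ n (choices ω) v := by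
    funext ω
    refine ballCount_congr s s₀ s₁ n v fun u hu => ?_
    have hu' : u ∈ S := by simpa [hS] using hu
    funext k
    simp only [choices, ext, hu', dite_true]
  rw [e] at h2
  have h3 := h2.map_prod_eq_prod_map_map (measurable_ballCount s s₀ s₁ n v).aemeasurable
    (measurable_pi_apply v).aemeasurable
  have h4 : (sampleLaw ν).map (fun ω => ω v) = vertexLaw ν :=
    Measure.infinitePi_map_eval (fun _ : Vertex b => vertexLaw ν) v
  refine Eq.trans ?_ (h3.trans (congrArg _ h4))
  rfl

lemma lintegral_ballCount_cons {b : ℕ} [NeZero b] (ν : Measure (Fin b → ℝ))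
    [IsProbabilityMeasure ν] (s s₀ s₁ n : ℕ) (g : ℕ → ℝ≥0∞) (v : Vertex b) :
    ∑ i, ∫⁻ ω, g (ballCount s s₀ s₁ n (choices ω) (i :: v)) ∂(sampleLaw ν) =
      ∫⁻ ω, childrenSum ν s s₀ s₁ g (ballCount s s₀ s₁ n (choices ω) v) ∂(sampleLaw ν) := by
  have hm : ∀ i : Fin b, Measurable fun p : ℕ × ((Fin b → ℝ) × (ℕ → unitInterval)) =>
      g (randomChildCount s s₀ s₁ i p.1 p.2) := fun i =>
    measurable_from_prod_countable_right fun m =>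
      (measurable_from_top (f := g)).comp (measurable_randomChildCount s s₀ s₁ i m)
  have hN := measurable_ballCount (b := b) s s₀ s₁ n v
  unfold childrenSum
  have hm' : ∀ i : Fin b, Measurable fun ω : Sample b =>
      ∫⁻ x, g (randomChildCount s s₀ s₁ i (ballCount s s₀ s₁ n (choices ω) v) x) ∂(vertexLaw ν) :=
    fun i => (measurable_from_top (f := fun m =>
      ∫⁻ x, g (randomChildCount s s₀ s₁ i m x) ∂(vertexLaw ν))).comp hN
  rw [lintegral_finsetSum _ fun i _ => hm' i]
  refine Finset.sum_congr rfl fun i _ => ?_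
  have e1 := lintegral_map (μ := sampleLaw ν) (hm i) (hN.prodMk (measurable_pi_apply v))
  have e2 := lintegral_map (μ := sampleLaw ν) (f := fun m =>
    ∫⁻ x, g (randomChildCount s s₀ s₁ i m x) ∂(vertexLaw ν)) measurable_from_top hN
  rw [map_ballCount_prodMk, lintegral_prod _ (hm i).aemeasurable, e2] at e1
  exact e1.symm

lemma sum_ofFn_succ {b : ℕ} {M : Type*} [AddCommMonoid M] (D : ℕ) (f : Vertex b → M) :
    ∑ p : Fin (D + 1) → Fin b, f (List.ofFn p) =
      ∑ p : Fin D → Fin b, ∑ i, f (i :: List.ofFn p) := by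
  rw [← (Fin.consEquiv fun _ => Fin b).sum_comp, Fintype.sum_prod_type, Finset.sum_comm]
  refine Finset.sum_congr rfl fun p _ => Finset.sum_congr rfl fun i _ => ?_
  simp [Fin.consEquiv]

lemma sum_lintegral_level {b : ℕ} [NeZero b] (ν : Measure (Fin b → ℝ)) [IsProbabilityMeasure ν]
    (s s₀ s₁ n D : ℕ) (g : ℕ → ℝ≥0∞) :
    ∑ p : Fin D → Fin b, ∫⁻ ω, g (ballCount s s₀ s₁ n (choices ω) (List.ofFn p)) ∂(sampleLaw ν) =
      (childrenSum ν s s₀ s₁)^[D] g n := by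
  induction D generalizing g with
  | zero => simp [ballCount]
  | succ D ih =>
    rw [sum_ofFn_succ D fun v => ∫⁻ ω, g (ballCount s s₀ s₁ n (choices ω) v) ∂(sampleLaw ν)]
    simp_rw [lintegral_ballCount_cons]
    rw [ih, Function.iterate_succ_apply]

/-- The expected number of vertices at depth `D`. -/
noncomputable def expectedLevel {b : ℕ} [NeZero b] (ν : Measure (Fin b → ℝ))
    [IsProbabilityMeasure ν] (s s₀ s₁ n D : ℕ) : ℝ≥0∞ :=
  ∑ p : Fin D → Fin b,
    sampleLaw ν {ω | 0 < ballCount s s₀ s₁ n (choices ω) (List.ofFn p)}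

/-- Each vertex is charged to its grandparent, which has at most `b ^ 2` grandchildren. A parent
would not do: for `b = 2`, `s = s₁ = 1`, `s₀ = 0`, a vertex with two balls has nonempty children but
only one ball beyond `s₁`. The scale `y = n` makes both terms of the bound at most `n ^ θ`. -/
lemma expectedLevel_le {b : ℕ} [NeZero b] (hb : 2 ≤ b) {ν : Measure (Fin b → ℝ)}
    [IsProbabilityMeasure ν] (h_pos : ∀ᵐ w ∂ν, ∀ i, 0 < w i) (h_sum : ∀ᵐ w ∂ν, ∑ i, w i = 1)
    {s s₀ s₁ n : ℕ} (hs : 0 < s) (hs₁ : b * s₁ ≤ s + 1 - s₀) (hn : 0 < n) {θ : ℝ}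
    (hθ0 : 0 ≤ θ) (hθ2 : θ ≤ 2) (D : ℕ) :
    expectedLevel ν s s₀ s₁ n D ≤
      ENNReal.ofReal (2 * b ^ 2 * (n : ℝ) ^ θ) * moment ν θ ^ (D - 2) := by
  have hn' : (0 : ℝ) < n := by exact_mod_cast hn
  have hn1 : (1 : ℝ) ≤ n := by exact_mod_cast hn
  have hb' : (1 : ℝ) ≤ b := by exact_mod_cast (by omega : 1 ≤ b)
  unfold expectedLevel
  rcases lt_or_ge D 2 with hD | hD
  · rw [show D - 2 = 0 by omega, pow_zero, mul_one]
    calc _ ≤ ∑ p : Fin D → Fin b, (1 : ℝ≥0∞) := Finset.sum_le_sum fun p _ => prob_le_one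
      _ = ENNReal.ofReal ((b : ℝ) ^ D) := by
        rw [ENNReal.ofReal_pow (by positivity)]
        simp
      _ ≤ _ := by
        refine ENNReal.ofReal_le_ofReal ?_
        have h1 : (b : ℝ) ^ D ≤ b ^ 2 := pow_le_pow_right₀ hb' hD.le
        have h2 : (1 : ℝ) ≤ (n : ℝ) ^ θ := Real.one_le_rpow hn1 hθ0
        nlinarith [sq_nonneg (b : ℝ)]
  · obtain ⟨D, rfl⟩ := Nat.exists_eq_add_of_le' hD
    have e := sum_lintegral_level ν s s₀ s₁ n D (fun m => if 2 ≤ m - s₁ then 1 else 0)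
    have hle := iterate_childrenSum_le h_pos h_sum s s₀ s₁ hθ0 hθ2 D n hn'
    rw [← e] at hle
    rw [sum_ofFn_succ (D + 1) fun v => sampleLaw ν {ω | 0 < ballCount s s₀ s₁ n (choices ω) v},
      sum_ofFn_succ D fun v => ∑ i : Fin b,
        sampleLaw ν {ω | 0 < ballCount s s₀ s₁ n (choices ω) (i :: v)}]
    calc _ ≤ ∑ p : Fin D → Fin b, ∑ _j : Fin b, ∑ _i : Fin b,
          ∫⁻ ω, (if 2 ≤ ballCount s s₀ s₁ n (choices ω) (List.ofFn p) - s₁ then 1 else 0)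
            ∂(sampleLaw ν) := by
          refine Finset.sum_le_sum fun p _ => Finset.sum_le_sum fun j _ =>
            Finset.sum_le_sum fun i _ => ?_
          have hmN := measurable_ballCount (b := b) s s₀ s₁ n
          have hm : MeasurableSet
              {ω : Sample b | 0 < ballCount s s₀ s₁ n (choices ω) (i :: j :: List.ofFn p)} :=
            measurableSet_lt measurable_const (hmN _)
          rw [← lintegral_indicator_one hm]
          refine lintegral_mono fun ω => ?_
          by_cases hω : 0 < ballCount s s₀ s₁ n (choices ω) (i :: j :: List.ofFn p)
          · simp only
            rw [if_pos (two_le_of_grandchild_pos hb hs hs₁ hω)]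
            exact Set.indicator_le_self _ _ ω
          · simp only [Set.indicator_apply, Set.mem_ofPred_eq, if_neg hω]
            exact zero_le
      _ = (b : ℝ≥0∞) ^ 2 * ∑ p : Fin D → Fin b,
          ∫⁻ ω, (if 2 ≤ ballCount s s₀ s₁ n (choices ω) (List.ofFn p) - s₁ then 1 else 0)
            ∂(sampleLaw ν) := by
          rw [Finset.mul_sum]
          refine Finset.sum_congr rfl fun p _ => ?_
          simp only [Finset.sum_const, Finset.card_univ, Fintype.card_fin, nsmul_eq_mul]
          ring
      _ ≤ (b : ℝ≥0∞) ^ 2 * (moment ν θ ^ D *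
          (pairs s₁ n * ENNReal.ofReal ((n : ℝ) ^ (θ - 2)) + ENNReal.ofReal ((n : ℝ) ^ θ))) := by
          gcongr
      _ ≤ (b : ℝ≥0∞) ^ 2 * (moment ν θ ^ D *
          (ENNReal.ofReal ((n : ℝ) ^ θ) + ENNReal.ofReal ((n : ℝ) ^ θ))) := by
          gcongr
          have hp : (pairs s₁ n : ℝ≥0∞) ≤ ENNReal.ofReal ((n : ℝ) ^ 2) := by
            rw [ENNReal.ofReal_pow hn'.le, ENNReal.ofReal_natCast, sq]
            exact_mod_cast Nat.mul_le_mul (Nat.sub_le _ _)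
              ((Nat.sub_le _ _).trans (Nat.sub_le _ _))
          refine (mul_le_mul_left hp _).trans ?_
          rw [← ENNReal.ofReal_mul (by positivity)]
          refine ENNReal.ofReal_le_ofReal (le_of_eq ?_)
          rw [Real.rpow_sub hn', Real.rpow_two]
          field_simp
      _ = _ := by
          rw [Nat.add_sub_cancel, ← ENNReal.ofReal_add (by positivity) (by positivity), ← two_mul,
            ENNReal.ofReal_mul (by positivity : (0 : ℝ) ≤ 2 * b ^ 2),
            ENNReal.ofReal_mul (by norm_num : (0 : ℝ) ≤ 2),
            ENNReal.ofReal_mul (by norm_num : (0 : ℝ) ≤ 2),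
            ENNReal.ofReal_pow (by positivity), ENNReal.ofReal_natCast]
          ring

/-- Linearity of expectation, with vertices grouped by depth. Monotonicity of the lower integral
avoids measurability of the number of bad vertices. -/
lemma expectedBad_le_tsum {b : ℕ} [NeZero b] (ν : Measure (Fin b → ℝ)) [IsProbabilityMeasure ν]
    {s s₀ s₁ : ℕ} (hs₀ : s₀ ≤ s) (hs₁ : b * s₁ ≤ s + 1 - s₀) (ε : ℝ) (n : ℕ) :
    open Classical in
    expectedBad ν ε s s₀ s₁ n ≤
      ∑' D : ℕ, if GoodDepth (mu ν) ε n D then 0 else expectedLevel ν s s₀ s₁ n D := by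
  classical
  have hm : ∀ v : Vertex b,
      MeasurableSet {ω : Sample b | 0 < ballCount s s₀ s₁ n (choices ω) v} := fun v =>
    measurableSet_lt measurable_const (measurable_ballCount s s₀ s₁ n v)
  calc _ ≤ ∫⁻ ω, ∑' v : Vertex b, (if GoodDepth (mu ν) ε n v.length then 0 else
          {ω : Sample b | 0 < ballCount s s₀ s₁ n (choices ω) v}.indicator 1 ω)
          ∂(sampleLaw ν) := by
        refine lintegral_mono fun ω => ?_
        rw [← ENNReal.tsum_set_one, tsum_subtype _ fun _ => (1 : ℝ≥0∞)]
        refine ENNReal.tsum_le_tsum fun v => ?_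
        by_cases hv : v ∈ badVertices (mu ν) ε s s₀ s₁ n (choices ω)
        · have hv' : 0 < ballCount s s₀ s₁ n (choices ω) v := vertices_subset hs₀ hs₁ n _ hv.1
          rw [if_neg hv.2, Set.indicator_of_mem hv]
          simp only [Set.indicator_apply, Set.mem_ofPred_eq, if_pos hv', Pi.one_apply, le_refl]
        · rw [Set.indicator_of_notMem hv]
          exact zero_le
    _ = ∑' v : Vertex b, (if GoodDepth (mu ν) ε n v.length then 0 else
          sampleLaw ν {ω : Sample b | 0 < ballCount s s₀ s₁ n (choices ω) v}) := by
        rw [lintegral_tsum]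
        · refine tsum_congr fun v => ?_
          split_ifs
          · simp
          · exact lintegral_indicator_one (hm v)
        · intro v
          split_ifs
          · exact aemeasurable_const
          · exact (measurable_one.indicator (hm v)).aemeasurable
    _ = _ := by
        rw [← List.equivSigmaTuple.symm.tsum_eq, ENNReal.tsum_sigma']
        refine tsum_congr fun D => ?_
        rw [tsum_fintype]
        unfold expectedLevel
        simp only [List.equivSigmaTuple, Equiv.coe_fn_symm_mk, List.length_ofFn]
        split_ifs <;> simp

/-! ### The moment function near exponent one -/

lemma exp_le_one_add_add_sq_mul_exp (x : ℝ) :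
    Real.exp x ≤ 1 + x + x ^ 2 * Real.exp |x| := by
  have h := Complex.norm_exp_sub_sum_le_norm_mul_exp x 2
  have e : Complex.exp x - ∑ m ∈ Finset.range 2, (x : ℂ) ^ m / m.factorial =
      ((Real.exp x - (1 + x) : ℝ) : ℂ) := by
    simp [Finset.sum_range_succ]
  rw [e, Complex.norm_real, Complex.norm_real, Real.norm_eq_abs, Real.norm_eq_abs, sq_abs] at h
  linarith [le_abs_self (Real.exp x - (1 + x))]

/-- Expand `exp (-tL)` to first order, `L = -log w`. The remainder carries `w L² exp (|t| L)`, and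
the factor `w = exp (-L)` keeps this bounded uniformly in `w` for `|t| ≤ 1/2`. -/
lemma rpow_one_add_le {w t : ℝ} (hw : 0 < w) (hw1 : w ≤ 1) (ht : |t| ≤ 1 / 2) :
    w ^ (1 + t) ≤ w - t * (w * -Real.log w) + 16 * t ^ 2 := by
  set L := -Real.log w with hL
  have hL0 : 0 ≤ L := neg_nonneg.2 (Real.log_nonpos hw.le hw1)
  have hwL : w = Real.exp (-L) := by rw [hL, neg_neg, Real.exp_log hw]
  have h1 : w ^ (1 + t) = w * Real.exp (-(t * L)) := by
    rw [Real.rpow_def_of_pos hw, show Real.log w = -L by rw [hL, neg_neg],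
      show -L * (1 + t) = -L + -(t * L) by ring, Real.exp_add, ← hwL]
  have h2 := exp_le_one_add_add_sq_mul_exp (-(t * L))
  have h3 : Real.exp |-(t * L)| ≤ Real.exp (L / 2) := by
    apply Real.exp_le_exp.2
    rw [abs_neg, abs_mul, abs_of_nonneg hL0]
    nlinarith
  -- From `L / 4 ≤ exp (L / 4)` one gets `L² ≤ 16 exp (L / 2)`, and `w` cancels the two factors `exp
  -- (L / 2)`.
  have h4 : w * (L ^ 2 * Real.exp (L / 2)) ≤ 16 := by
    have h5 : L / 4 + 1 ≤ Real.exp (L / 4) := Real.add_one_le_exp _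
    have h6 : L ^ 2 ≤ 16 * (Real.exp (L / 4)) ^ 2 := by nlinarith
    have h7 : Real.exp (L / 4) ^ 2 = Real.exp (L / 2) := by
      rw [← Real.exp_nat_mul]; congr 1; push_cast; ring
    rw [h7] at h6
    have h8 : w * (Real.exp (L / 2) * Real.exp (L / 2)) = 1 := by
      rw [hwL, ← Real.exp_add, ← Real.exp_add, ← Real.exp_zero]; congr 1; ring
    have h9 := mul_le_mul_of_nonneg_left h6
      (mul_nonneg hw.le (Real.exp_pos (L / 2)).le)
    nlinarith
  rw [h1]
  have h10 : w * Real.exp (-(t * L)) ≤ w * (1 + -(t * L) + (-(t * L)) ^ 2 * Real.exp (L / 2)) :=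
    mul_le_mul_of_nonneg_left (h2.trans (by gcongr)) hw.le
  have h11 := mul_le_mul_of_nonneg_left h4 (sq_nonneg t)
  nlinarith

lemma integrable_entropy {b : ℕ} {ν : Measure (Fin b → ℝ)} [IsProbabilityMeasure ν]
    (h_pos : ∀ᵐ w ∂ν, ∀ i, 0 < w i) (h_sum : ∀ᵐ w ∂ν, ∑ i, w i = 1) :
    Integrable (fun w => ∑ j, w j * -Real.log (w j)) ν := by
  refine integrable_finsetSum _ fun j _ => ?_
  have hm : Measurable fun w : Fin b → ℝ => w j * -Real.log (w j) :=
    (measurable_pi_apply j).mul (Real.measurable_log.comp (measurable_pi_apply j)).neg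
  refine Integrable.of_bound hm.aestronglyMeasurable 1 ?_
  filter_upwards [h_pos, h_sum] with w hw hs
  have h1 : w j ≤ 1 := hs ▸ Finset.single_le_sum (fun i _ => (hw i).le) (Finset.mem_univ j)
  have h2 := Real.log_nonpos (hw j).le h1
  have h3 := Real.one_sub_inv_le_log_of_pos (hw j)
  rw [Real.norm_of_nonneg (mul_nonneg (hw j).le (by linarith))]
  have h4 : w j * (w j)⁻¹ = 1 := mul_inv_cancel₀ (hw j).ne'
  nlinarith [hw j]

lemma mu_pos {b : ℕ} {ν : Measure (Fin b → ℝ)} [IsProbabilityMeasure ν]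
    (h_pos : ∀ᵐ w ∂ν, ∀ i, 0 < w i) (h_sum : ∀ᵐ w ∂ν, ∑ i, w i = 1)
    (h_one : ∀ᵐ w ∂ν, ∀ i, w i ≠ 1) : 0 < mu ν := by
  have hpos : ∀ᵐ w ∂ν, 0 < ∑ j, w j * -Real.log (w j) := by
    filter_upwards [h_pos, h_sum, h_one] with w hw hs h1
    have hlt : ∀ j, w j < 1 := fun j => lt_of_le_of_ne
      (hs ▸ Finset.single_le_sum (fun i _ => (hw i).le) (Finset.mem_univ j)) (h1 j)
    refine Finset.sum_pos (fun j _ => mul_pos (hw j) (neg_pos.2 (Real.log_neg (hw j) (hlt j)))) ?_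
    by_contra hne
    rw [Finset.not_nonempty_iff_eq_empty.1 hne, Finset.sum_empty] at hs
    exact zero_ne_one hs
  unfold mu
  rw [integral_pos_iff_support_of_nonneg_ae (hpos.mono fun w h => h.le)
    (integrable_entropy h_pos h_sum)]
  rw [pos_iff_ne_zero]
  intro h0
  have : ∀ᵐ w ∂ν, False := by
    have h0' : ∀ᵐ w ∂ν, w ∉ Function.support fun w : Fin b → ℝ => ∑ j, w j * -Real.log (w j) :=
      measure_eq_zero_iff_ae_notMem.1 h0
    filter_upwards [hpos, h0'] with w h1 h2
    exact h2 h1.ne'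
  exact this.exists.elim fun _ h => h

lemma moment_le {b : ℕ} {ν : Measure (Fin b → ℝ)} [IsProbabilityMeasure ν]
    (h_pos : ∀ᵐ w ∂ν, ∀ i, 0 < w i) (h_sum : ∀ᵐ w ∂ν, ∑ i, w i = 1) {t : ℝ} (ht : |t| ≤ 1 / 2) :
    moment ν (1 + t) ≤ ENNReal.ofReal (Real.exp (-t * mu ν + 16 * b * t ^ 2)) := by
  have hint := integrable_entropy h_pos h_sum
  have hF : Integrable
      (fun w => 1 - t * (∑ j, w j * -Real.log (w j)) + 16 * b * t ^ 2) ν :=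
    ((integrable_const 1).sub (hint.const_mul t)).add (integrable_const _)
  have hle : ∀ᵐ w ∂ν, ∑ i, w i ^ (1 + t) ≤
      1 - t * (∑ j, w j * -Real.log (w j)) + 16 * b * t ^ 2 := by
    filter_upwards [h_pos, h_sum] with w hw hs
    calc ∑ i, w i ^ (1 + t) ≤ ∑ i, (w i - t * (w i * -Real.log (w i)) + 16 * t ^ 2) :=
          Finset.sum_le_sum fun i _ => rpow_one_add_le (hw i)
            (hs ▸ Finset.single_le_sum (fun i _ => (hw i).le) (Finset.mem_univ i)) ht
      _ = _ := by
          rw [Finset.sum_add_distrib, Finset.sum_sub_distrib, hs, ← Finset.mul_sum,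
            Finset.sum_const, Finset.card_univ, Fintype.card_fin, nsmul_eq_mul]
          ring
  unfold moment
  have hm : ∀ i : Fin b, Measurable fun w : Fin b → ℝ => ENNReal.ofReal (w i ^ (1 + t)) :=
    fun i => ENNReal.measurable_ofReal.comp ((measurable_pi_apply i).pow_const (1 + t))
  rw [← lintegral_finsetSum _ fun i _ => hm i]
  calc _ = ∫⁻ w, ENNReal.ofReal (∑ i, w i ^ (1 + t)) ∂ν := by
        refine lintegral_congr_ae ?_
        filter_upwards [h_pos] with w hw
        exact (ENNReal.ofReal_sum_of_nonneg fun i _ => Real.rpow_nonneg (hw i).le _).symm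
    _ ≤ ∫⁻ w, ENNReal.ofReal (1 - t * (∑ j, w j * -Real.log (w j)) + 16 * b * t ^ 2) ∂ν :=
        lintegral_mono_ae (hle.mono fun w h => ENNReal.ofReal_le_ofReal h)
    _ = ENNReal.ofReal (1 - t * mu ν + 16 * b * t ^ 2) := by
        rw [← ofReal_integral_eq_lintegral_ofReal hF]
        · congr 1
          have hF' : Integrable (fun w => 1 - t * (∑ j, w j * -Real.log (w j))) ν :=
            (integrable_const 1).sub (hint.const_mul t)
          rw [integral_add hF' (integrable_const _),
            integral_sub (integrable_const 1) (hint.const_mul t), integral_const_mul]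
          simp [mu]
        · filter_upwards [hle, h_pos] with w h hw
          exact (Finset.sum_nonneg fun i _ => Real.rpow_nonneg (hw i).le _).trans h
    _ ≤ _ := by
        refine ENNReal.ofReal_le_ofReal ?_
        have := Real.add_one_le_exp (-t * mu ν + 16 * b * t ^ 2)
        linarith

lemma expectedLevel_le_exp {b : ℕ} [NeZero b] (hb : 2 ≤ b) {ν : Measure (Fin b → ℝ)}
    [IsProbabilityMeasure ν] (h_pos : ∀ᵐ w ∂ν, ∀ i, 0 < w i) (h_sum : ∀ᵐ w ∂ν, ∑ i, w i = 1)
    {s s₀ s₁ n : ℕ} (hs : 0 < s) (hs₁ : b * s₁ ≤ s + 1 - s₀) (hn : 0 < n) {t : ℝ}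
    (ht : |t| ≤ 1 / 2) (D : ℕ) :
    expectedLevel ν s s₀ s₁ n D ≤ ENNReal.ofReal (2 * b ^ 2 *
      Real.exp ((1 + t) * Real.log n + (-t * mu ν + 16 * b * t ^ 2) * ((D - 2 : ℕ) : ℝ))) := by
  have ht' := abs_le.1 ht
  have hn' : (0 : ℝ) < n := by exact_mod_cast hn
  refine (expectedLevel_le hb h_pos h_sum hs hs₁ hn (by linarith : 0 ≤ 1 + t) (by linarith)
    D).trans ?_
  refine (mul_le_mul_right (pow_le_pow_left' (moment_le h_pos h_sum ht) (D - 2)) _).trans ?_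
  rw [← ENNReal.ofReal_pow (Real.exp_pos _).le, ← ENNReal.ofReal_mul (by positivity),
    ← Real.exp_nat_mul, Real.exp_add, Real.rpow_def_of_pos hn', mul_assoc]
  refine ENNReal.ofReal_le_ofReal (le_of_eq ?_)
  rw [mul_comm (Real.log n), mul_comm ((D - 2 : ℕ) : ℝ)]

/-! ### Chernoff exponents and summation over depths -/

/-- The terms linear in `c r` sum to at most `-c μ r² l`; the quadratic cost is at most half of this
by the choice of `c`. -/
lemma shallow_exponent_le {μ K c r l k : ℝ} (hμ : 0 < μ) (hK : 0 < K) (hc : 0 < c)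
    (hKc : K * c * (μ⁻¹ + 2) ≤ μ / 2) (hr : 0 < r) (hl : 0 < l)
    (hk : k ≤ μ⁻¹ * l - r * l) :
    (1 + -(c * r)) * l + (-(-(c * r)) * μ + K * (-(c * r)) ^ 2) * k ≤
      l - c * μ / 2 * (r ^ 2 * l) := by
  have h1 : (c * r * μ + K * (c * r) ^ 2) * k ≤ (c * r * μ + K * (c * r) ^ 2) * (μ⁻¹ * l - r * l) :=
    mul_le_mul_of_nonneg_left hk (by positivity)
  have h2 : c * r * μ * (μ⁻¹ * l) = c * r * l := by field_simp
  have h3 : K * (c * r) ^ 2 * (μ⁻¹ * l) ≤ c * (r ^ 2 * l) * (μ / 2) := by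
    have h4 : K * c * μ⁻¹ ≤ μ / 2 := by nlinarith [mul_pos hK hc]
    have h5 := mul_le_mul_of_nonneg_left h4 (by positivity : 0 ≤ c * (r ^ 2 * l))
    nlinarith
  have h6 : 0 ≤ K * (c * r) ^ 2 * (r * l) := by positivity
  nlinarith

/-- Here `η` is the decay rate per level. Beyond the window, `j` further levels give a geometric
factor; the two levels lost in passing to grandparents cost at most `2η ≤ μ`. -/
lemma deep_exponent_le {μ K c r l j k : ℝ} (hμ : 0 < μ) (hK : 0 < K) (hc : 0 < c)
    (hc4 : c ≤ 1 / 4) (hKc : K * c * (μ⁻¹ + 2) ≤ μ / 2) (hr : 0 < r) (hr1 : r ≤ 1) (hl : 0 < l)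
    (hj : 0 ≤ j) (hk : μ⁻¹ * l + r * l + j - 2 ≤ k) :
    (1 + c * r) * l + (-(c * r) * μ + K * (c * r) ^ 2) * k ≤
      μ + (l - c * μ / 2 * (r ^ 2 * l)) + j * -(c * μ / 2 * r) := by
  have hcr : 0 < c * r := mul_pos hc hr
  have hμ' : 0 < μ⁻¹ := inv_pos.2 hμ
  have h0 : K * (c * r) ≤ μ / 2 := by
    have : 0 < K * c := mul_pos hK hc
    nlinarith
  set η := c * r * μ - K * (c * r) ^ 2 with hη
  have h1 : c * μ / 2 * r ≤ η := by nlinarith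
  have h2 : η ≤ μ / 4 := by
    have : c * r ≤ 1 / 4 := by nlinarith
    have := mul_le_mul_of_nonneg_right this hμ.le
    nlinarith [mul_pos hK (pow_pos hcr 2)]
  have h3 : 0 ≤ η := le_trans (by positivity) h1
  have h4 : η * (μ⁻¹ * l + r * l + j - 2) ≤ η * k := mul_le_mul_of_nonneg_left hk h3
  have h5 : c * r * μ * (μ⁻¹ * l) = c * r * l := by field_simp
  have h6 : K * (c * r) ^ 2 * (μ⁻¹ * l + r * l) ≤ c * μ / 2 * (r ^ 2 * l) := by
    have h7 : K * c * (μ⁻¹ + r) ≤ μ / 2 :=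
      le_trans (mul_le_mul_of_nonneg_left (by linarith) (by positivity)) hKc
    have h8 := mul_le_mul_of_nonneg_left h7 (by positivity : 0 ≤ c * (r ^ 2 * l))
    nlinarith
  have h9 : c * μ / 2 * r * j ≤ η * j := mul_le_mul_of_nonneg_right h1 hj
  have h10 : η * (μ⁻¹ * l + r * l) =
      c * r * μ * (μ⁻¹ * l) + c * μ * (r ^ 2 * l) - K * (c * r) ^ 2 * (μ⁻¹ * l + r * l) := by
    rw [hη]; ring
  have h11 : -(c * r) * μ + K * (c * r) ^ 2 = -η := by rw [hη]; ring
  rw [h11]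
  nlinarith

lemma tsum_ite_lt (M : ℕ) (x : ℝ≥0∞) : ∑' D : ℕ, (if D < M then x else 0) = M * x := by
  rw [tsum_eq_sum (s := Finset.range M) fun D hD => if_neg fun h => hD (Finset.mem_range.2 h),
    Finset.sum_congr rfl fun D hD => if_pos (Finset.mem_range.1 hD)]
  simp

lemma tsum_ite_le_sub (M : ℕ) (f : ℕ → ℝ≥0∞) :
    ∑' D : ℕ, (if M ≤ D then f (D - M) else 0) = ∑' j, f j := by
  rw [← Summable.sum_add_tsum_nat_add' (k := M) ENNReal.summable, Finset.sum_eq_zero, zero_add]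
  · simp
  · exact fun D hD => if_neg (not_le.2 (Finset.mem_range.1 hD))

lemma tsum_exp_geometric_le {z : ℝ} (hz : 0 < z) :
    ∑' j : ℕ, ENNReal.ofReal (Real.exp (j * -z)) ≤ ENNReal.ofReal (1 + z⁻¹) := by
  have h1 : ∀ j : ℕ, ENNReal.ofReal (Real.exp (j * -z)) = ENNReal.ofReal (Real.exp (-z)) ^ j :=
    fun j => by rw [Real.exp_nat_mul, ENNReal.ofReal_pow (Real.exp_pos _).le]
  have h2 : Real.exp (-z) < 1 := by
    rw [← Real.exp_zero]
    exact Real.exp_lt_exp.2 (neg_lt_zero.2 hz)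
  simp_rw [h1]
  rw [ENNReal.tsum_geometric, ← ENNReal.ofReal_one, ← ENNReal.ofReal_sub _ (Real.exp_pos _).le,
    ← ENNReal.ofReal_inv_of_pos (sub_pos.2 h2)]
  refine ENNReal.ofReal_le_ofReal ?_
  have h3 : Real.exp (-z) ≤ (1 + z)⁻¹ := by
    rw [Real.exp_neg]
    exact inv_anti₀ (by positivity) (by linarith [Real.add_one_le_exp z])
  have h4 : (1 + z⁻¹)⁻¹ = 1 - (1 + z)⁻¹ := by field_simp; ring
  rw [inv_le_comm₀ (sub_pos.2 h2) (by positivity), h4]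
  linarith

/-- The expected number of vertices at depths outside a window of relative width `r`. -/
lemma tsum_outside_window_le {E : ℕ → ℝ≥0∞} {A μ K c r l : ℝ} (hA : 0 < A) (hμ : 0 < μ)
    (hK : 0 < K) (hc : 0 < c) (hc4 : c ≤ 1 / 4) (hKc : K * c * (μ⁻¹ + 2) ≤ μ / 2) (hr : 0 < r)
    (hr1 : r ≤ 1) (hl : 0 < l)
    (hE : ∀ t : ℝ, |t| ≤ 1 / 2 → ∀ D : ℕ, E D ≤ ENNReal.ofReal
      (A * Real.exp ((1 + t) * l + (-t * μ + K * t ^ 2) * ((D - 2 : ℕ) : ℝ))))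
    {P : ℕ → Prop} [DecidablePred P]
    (hP : ∀ D : ℕ, μ⁻¹ * l - r * l ≤ D → (D : ℝ) ≤ μ⁻¹ * l + r * l → P D) :
    ∑' D, (if P D then 0 else E D) ≤ ENNReal.ofReal
      (A * Real.exp μ * Real.exp (l - c * μ / 2 * (r ^ 2 * l)) *
        (μ⁻¹ * l + 2 + (c * μ / 2 * r)⁻¹)) := by
  have ht : |c * r| ≤ 1 / 2 := by
    rw [abs_of_pos (mul_pos hc hr)]; nlinarith
  set X := A * Real.exp μ * Real.exp (l - c * μ / 2 * (r ^ 2 * l)) with hX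
  have hX0 : 0 < X := by positivity
  set M := ⌈μ⁻¹ * l⌉₊ with hM
  set D₀ := ⌈μ⁻¹ * l + r * l⌉₊ with hD₀
  -- Shallow depths number at most `M` and share one bound; deep depths are dominated by a geometric
  -- series starting at `D₀`.
  have hterm : ∀ D, (if P D then 0 else E D) ≤ (if D < M then ENNReal.ofReal X else 0) +
      (if D₀ ≤ D then ENNReal.ofReal X *
        ENNReal.ofReal (Real.exp ((D - D₀ : ℕ) * -(c * μ / 2 * r))) else 0) := by
    intro D
    by_cases hPD : P D
    · rw [if_pos hPD]
      exact zero_le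
    rw [if_neg hPD]
    rcases lt_or_ge (D : ℝ) (μ⁻¹ * l - r * l) with h | h
    · refine le_trans ?_ le_self_add
      have hDM : D < M := Nat.lt_ceil.2 (h.trans (by linarith [mul_pos hr hl]))
      rw [if_pos hDM]
      refine (hE (-(c * r)) (by rwa [abs_neg]) D).trans (ENNReal.ofReal_le_ofReal ?_)
      have hkD : ((D - 2 : ℕ) : ℝ) ≤ D := by exact_mod_cast Nat.sub_le D 2
      have := shallow_exponent_le hμ hK hc hKc hr hl (hkD.trans h.le)
      rw [hX, mul_assoc, ← Real.exp_add]
      exact mul_le_mul_of_nonneg_left (Real.exp_le_exp.2 (by linarith)) hA.le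
    · refine le_trans ?_ le_add_self
      have h' : μ⁻¹ * l + r * l < D := not_le.1 fun h' => hPD (hP D h h')
      have hDM : D₀ ≤ D := Nat.ceil_le.2 h'.le
      rw [if_pos hDM, ← ENNReal.ofReal_mul hX0.le]
      refine (hE (c * r) ht D).trans (ENNReal.ofReal_le_ofReal ?_)
      have h1 : (D : ℝ) ≤ ((D - 2 : ℕ) : ℝ) + 2 := by exact_mod_cast (by omega : D ≤ D - 2 + 2)
      have h2 := Nat.le_ceil (μ⁻¹ * l + r * l)
      have h3 : ((D - D₀ : ℕ) : ℝ) = D - D₀ := Nat.cast_sub hDM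
      have := deep_exponent_le hμ hK hc hc4 hKc hr hr1 hl (Nat.cast_nonneg (D - D₀))
        (k := ((D - 2 : ℕ) : ℝ)) (by rw [h3]; linarith)
      rw [hX, mul_assoc A, mul_assoc A, ← Real.exp_add, ← Real.exp_add]
      gcongr
  have hz : 0 < c * μ / 2 * r := by positivity
  calc _ ≤ _ := ENNReal.tsum_le_tsum hterm
    _ = M * ENNReal.ofReal X + ENNReal.ofReal X *
        ∑' j : ℕ, ENNReal.ofReal (Real.exp (j * -(c * μ / 2 * r))) := by
      rw [ENNReal.tsum_add, tsum_ite_lt, tsum_ite_le_sub D₀ fun j => ENNReal.ofReal X *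
        ENNReal.ofReal (Real.exp (j * -(c * μ / 2 * r))), ENNReal.tsum_mul_left]
    _ ≤ ENNReal.ofReal (μ⁻¹ * l + 1) * ENNReal.ofReal X +
        ENNReal.ofReal X * ENNReal.ofReal (1 + (c * μ / 2 * r)⁻¹) := by
      gcongr
      · rw [← ENNReal.ofReal_natCast]
        exact ENNReal.ofReal_le_ofReal (Nat.ceil_lt_add_one (by positivity)).le
      · exact tsum_exp_geometric_le hz
    _ = _ := by
      rw [← ENNReal.ofReal_mul (by positivity), ← ENNReal.ofReal_mul hX0.le,
        ← ENNReal.ofReal_add (by positivity) (by positivity)]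
      congr 1
      ring

/-! ### Absorbing polynomial factors and choosing the parameters -/

/-- Powers are dominated by the exponential of a small power. -/
lemma exists_rpow_le_exp (p : ℝ) {β a : ℝ} (hβ : 0 < β) (ha : 0 < a) :
    ∃ C : ℝ, 0 < C ∧ ∀ l : ℝ, 1 / 2 ≤ l → l ^ p ≤ C * Real.exp (β * l ^ a) := by
  obtain ⟨N, hN⟩ := exists_nat_ge (p / a)
  -- The first summand comes from the `N`-th term of the exponential series when `l ≥ 1`; the second
  -- covers `1 / 2 ≤ l ≤ 1`.
  refine ⟨N.factorial / β ^ N + 2 ^ |p|, by positivity, fun l hl => ?_⟩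
  have hl0 : 0 < l := by linarith
  rw [add_mul]
  rcases le_total 1 l with h1 | h1
  · have h2 : l ^ p ≤ (l ^ a) ^ N := by
      rw [← Real.rpow_natCast, ← Real.rpow_mul hl0.le]
      exact Real.rpow_le_rpow_of_exponent_le h1 ((div_le_iff₀' ha).1 hN)
    have h3 := Real.pow_div_factorial_le_exp (β * l ^ a) (by positivity) N
    rw [div_le_iff₀ (by positivity), mul_pow] at h3
    have h4 : (l ^ a) ^ N ≤ N.factorial / β ^ N * Real.exp (β * l ^ a) := by
      rw [div_mul_eq_mul_div, le_div_iff₀ (by positivity)]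
      linarith
    have h5 : 0 ≤ (2 : ℝ) ^ |p| * Real.exp (β * l ^ a) := by positivity
    linarith
  · have h2 : l ^ p ≤ 2 ^ |p| := by
      calc l ^ p ≤ l ^ (-|p|) :=
            Real.rpow_le_rpow_of_exponent_ge hl0 h1 (neg_abs_le p)
        _ = l⁻¹ ^ |p| := by rw [Real.rpow_neg hl0.le, Real.inv_rpow hl0.le]
        _ ≤ 2 ^ |p| := by
            refine Real.rpow_le_rpow (by positivity) ?_ (abs_nonneg p)
            rw [inv_le_comm₀ hl0 two_pos]
            linarith
    have h3 : 1 ≤ Real.exp (β * l ^ a) := Real.one_le_exp (by positivity)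
    have h4 : 0 ≤ N.factorial / β ^ N * Real.exp (β * l ^ a) := by positivity
    have h5 : 0 < (2 : ℝ) ^ |p| := by positivity
    nlinarith

lemma exists_rpow_le_exp_min (p : ℝ) {β a : ℝ} (hβ : 0 < β) (ha : 0 < a) :
    ∃ C : ℝ, 0 < C ∧ ∀ l : ℝ, 1 / 2 ≤ l → l ^ p ≤ C * Real.exp (β * min (l ^ a) l) := by
  obtain ⟨C₁, h₁, H₁⟩ := exists_rpow_le_exp p hβ ha
  obtain ⟨C₂, h₂, H₂⟩ := exists_rpow_le_exp p hβ one_pos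
  refine ⟨C₁ + C₂, by positivity, fun l hl => ?_⟩
  have h3 := H₁ l hl
  have h4 := H₂ l hl
  rw [Real.rpow_one] at h4
  rcases min_choice (l ^ a) l with h | h <;> rw [h, add_mul]
  · have : 0 ≤ C₂ * Real.exp (β * l ^ a) := by positivity
    linarith
  · have : 0 ≤ C₁ * Real.exp (β * l) := by positivity
    linarith

lemma half_le_log {n : ℕ} (hn : 2 ≤ n) : 1 / 2 ≤ Real.log n := by
  have h : Real.log 2 ≤ Real.log n := Real.log_le_log two_pos (by exact_mod_cast hn)
  linarith [Real.log_two_gt_d9]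

lemma exists_expectedBad_le {b : ℕ} [NeZero b] (hb : 2 ≤ b) {ν : Measure (Fin b → ℝ)}
    [IsProbabilityMeasure ν] (h_pos : ∀ᵐ w ∂ν, ∀ i, 0 < w i) (h_sum : ∀ᵐ w ∂ν, ∑ i, w i = 1)
    (h_one : ∀ᵐ w ∂ν, ∀ i, w i ≠ 1) {s s₀ s₁ : ℕ} (hs : 0 < s) (hs₀ : s₀ ≤ s)
    (hs₁ : b * s₁ ≤ s + 1 - s₀) {ε : ℝ} (hε : 0 < ε) :
    ∃ B : ℝ, 0 < B ∧ ∃ C : ℝ, 0 < C ∧ ∀ n : ℕ, 2 ≤ n → expectedBad ν ε s s₀ s₁ n ≤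
      ENNReal.ofReal
        (C * (n * Real.exp (-B * min (Real.log n ^ (2 * ε)) (Real.log n)))) := by
  have hμ : 0 < mu ν := mu_pos h_pos h_sum h_one
  set μ := mu ν with hμdef
  have hb0 : (0 : ℝ) < b := by exact_mod_cast (by omega : 0 < b)
  have hK : (0 : ℝ) < 16 * b := by positivity
  have hμ' : 0 < μ⁻¹ := inv_pos.2 hμ
  obtain ⟨c, hc, hc4, hKc⟩ : ∃ c : ℝ, 0 < c ∧ c ≤ 1 / 4 ∧ 16 * b * c * (μ⁻¹ + 2) ≤ μ / 2 := by
    refine ⟨min (1 / 4) (μ / (2 * (16 * b * (μ⁻¹ + 2)))), by positivity, min_le_left _ _, ?_⟩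
    have h := min_le_right (1 / 4) (μ / (2 * (16 * b * (μ⁻¹ + 2))))
    rw [le_div_iff₀ (by positivity)] at h
    linarith
  set β := c * μ / 2 with hβdef
  have hβ : 0 < β := by positivity
  -- Half of the rate `β` is reserved for the prefactor: `C₁` handles the number of shallow levels,
  -- of order `l`, and `C₂` the factor `r⁻¹` from the geometric series.
  obtain ⟨C₁, hC₁, H₁⟩ := exists_rpow_le_exp_min 1 (half_pos hβ) (by positivity : 0 < 2 * ε)
  obtain ⟨C₂, hC₂, H₂⟩ :=
    exists_rpow_le_exp_min (1 / 2 - ε) (half_pos hβ) (by positivity : 0 < 2 * ε)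
  refine ⟨β / 2, half_pos hβ,
    2 * b ^ 2 * Real.exp μ * (μ⁻¹ * C₁ + 2 + β⁻¹ * (1 + C₂)), by positivity, fun n hn => ?_⟩
  set l := Real.log n with hldef
  have hl : 1 / 2 ≤ l := half_le_log hn
  have hl0 : 0 < l := by linarith
  have hn0 : 0 < n := by omega
  set y := min (l ^ (2 * ε)) l with hy
  have hy0 : 0 < y := by positivity
  -- The cap at one keeps the tilt `c r` in the range of the moment estimate when `ε > 1/2`;
  -- shrinking the window only enlarges the set of depths summed over.
  set r := min (l ^ (ε - 1 / 2)) 1 with hr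
  have hr0 : 0 < r := by positivity
  have hry : r ^ 2 * l = y := by
    have e : (l ^ (ε - 1 / 2)) ^ 2 * l = l ^ (2 * ε) := by
      rw [← Real.rpow_natCast, ← Real.rpow_mul hl0.le]
      nth_rw 2 [← Real.rpow_one l]
      rw [← Real.rpow_add hl0]
      congr 1
      push_cast
      ring
    have hx0 : 0 < l ^ (ε - 1 / 2) := by positivity
    rcases le_total (l ^ (ε - 1 / 2)) 1 with h | h
    · rw [hr, hy, min_eq_left h, e, min_eq_left]
      rw [← e]
      nlinarith [pow_le_one₀ hx0.le h (n := 2)]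
    · rw [hr, hy, min_eq_right h, one_pow, one_mul, min_eq_right]
      rw [← e]
      nlinarith [one_le_pow₀ h (n := 2)]
  have hrinv : r⁻¹ ≤ 1 + l ^ (1 / 2 - ε) := by
    have e : (l ^ (ε - 1 / 2))⁻¹ = l ^ (1 / 2 - ε) := by
      rw [← Real.rpow_neg hl0.le, neg_sub]
    have h0 : 0 < l ^ (1 / 2 - ε) := by positivity
    rcases min_choice (l ^ (ε - 1 / 2)) 1 with h | h <;> rw [hr, h]
    · rw [e]; linarith
    · rw [inv_one]; linarith
  have hrl : r * l ≤ l ^ (0.5 + ε) := by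
    calc r * l ≤ l ^ (ε - 1 / 2) * l := mul_le_mul_of_nonneg_right (min_le_left _ _) hl0.le
      _ = l ^ (0.5 + ε) := by
        nth_rw 2 [← Real.rpow_one l]
        rw [← Real.rpow_add hl0]
        congr 1
        norm_num
        ring
  classical
  have hmain := tsum_outside_window_le (E := fun D => expectedLevel ν s s₀ s₁ n D)
    (A := 2 * b ^ 2) (by positivity) hμ hK hc hc4 hKc hr0 (min_le_right _ _) hl0
    (fun t ht D => expectedLevel_le_exp hb h_pos h_sum hs hs₁ hn0 ht D)
    (P := fun D => GoodDepth μ ε n D) (fun D h1 h2 => ⟨by linarith, by linarith⟩)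
  refine (expectedBad_le_tsum ν hs₀ hs₁ ε n).trans (hmain.trans (ENNReal.ofReal_le_ofReal ?_))
  rw [hry, ← hβdef]
  have hexp1 : Real.exp (l - β * y) =
      n * Real.exp (-(β / 2) * y) * (Real.exp (β / 2 * y))⁻¹ := by
    rw [← Real.exp_neg, mul_assoc, ← Real.exp_add, sub_eq_add_neg, Real.exp_add,
      Real.exp_log (by exact_mod_cast hn0)]
    ring_nf
  have hg : 1 ≤ Real.exp (β / 2 * y) := Real.one_le_exp (by positivity)
  have H₁' := H₁ l hl
  have H₂' := H₂ l hl
  rw [Real.rpow_one] at H₁'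
  have hfac : μ⁻¹ * l + 2 + (β * r)⁻¹ ≤
      (μ⁻¹ * C₁ + 2 + β⁻¹ * (1 + C₂)) * Real.exp (β / 2 * y) := by
    have h1 := mul_le_mul_of_nonneg_left H₁' hμ'.le
    have h2 : (β * r)⁻¹ ≤ β⁻¹ * ((1 + C₂) * Real.exp (β / 2 * y)) := by
      rw [mul_inv]
      refine mul_le_mul_of_nonneg_left ?_ (inv_pos.2 hβ).le
      linarith
    linarith
  calc _ = 2 * b ^ 2 * Real.exp μ * (n * Real.exp (-(β / 2) * y)) *
        ((Real.exp (β / 2 * y))⁻¹ * (μ⁻¹ * l + 2 + (β * r)⁻¹)) := by rw [hexp1]; ring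
    _ ≤ 2 * b ^ 2 * Real.exp μ * (n * Real.exp (-(β / 2) * y)) *
        (μ⁻¹ * C₁ + 2 + β⁻¹ * (1 + C₂)) := by
      gcongr
      rw [inv_mul_le_iff₀ (Real.exp_pos _)]
      linarith
    _ = _ := by ring

end SplitTree

theorem mainTheorem2 (b : ℕ) [NeZero b] (s s₀ s₁ : ℕ)
    (hs : 0 < s) (hs₀ : s₀ ≤ s) (hs₁ : b * s₁ ≤ s + 1 - s₀)
    (ν : Measure (Fin b → ℝ)) [IsProbabilityMeasure ν] (hν : SplitTree.IsSplitVectorLaw ν)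
    (h_one : ∀ i, ν {w | w i = 1} = 0) (h_zero : ∀ i, ν {w | w i = 0} = 0)
    (h_nonlattice : ∀ i, SplitTree.NonLattice (ν.map fun w => -Real.log (w i)))
    (ε : ℝ) (hε : 0 < ε) :
    (∀ k : ℝ, ∃ C : ℝ, ∀ n : ℕ, 2 ≤ n →
      SplitTree.expectedBad ν ε s s₀ s₁ n ≤ ENNReal.ofReal (C * (n / Real.log n ^ k))) ∧
    (ε ≤ 1 / 2 → ∃ B : ℝ, 0 < B ∧ ∃ C : ℝ, ∀ n : ℕ, 2 ≤ n →
      SplitTree.expectedBad ν ε s s₀ s₁ n ≤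
        ENNReal.ofReal (C * (n * Real.exp (-B * Real.log n ^ (2 * ε))))) := by
  have h_one' : ∀ᵐ w ∂ν, ∀ i, w i ≠ 1 :=
    ae_all_iff.2 fun i => measure_eq_zero_iff_ae_notMem.1 (h_one i)
  have h_zero' : ∀ᵐ w ∂ν, ∀ i, w i ≠ 0 :=
    ae_all_iff.2 fun i => measure_eq_zero_iff_ae_notMem.1 (h_zero i)
  have h_pos : ∀ᵐ w ∂ν, ∀ i, 0 < w i := by
    filter_upwards [hν.nonneg, h_zero'] with w h1 h2 i
    exact lt_of_le_of_ne (h1 i) (h2 i).symm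
  -- With one child, the only component would equal one almost surely.
  have hb : 2 ≤ b := by
    by_contra hb
    obtain rfl : b = 1 := by have := NeZero.ne b; omega
    obtain ⟨w, h1, h2⟩ := (hν.sum_eq_one.and h_one').exists
    exact h2 0 (by simpa using h1)
  obtain ⟨B, hB, C, hC, H⟩ := SplitTree.exists_expectedBad_le hb h_pos hν.sum_eq_one h_one' hs hs₀
    hs₁ hε
  refine ⟨fun k => ?_, fun hε2 => ⟨B / 2, half_pos hB, C, fun n hn => (H n hn).trans ?_⟩⟩
  · obtain ⟨C', hC', H'⟩ := SplitTree.exists_rpow_le_exp_min k hB (by positivity : 0 < 2 * ε)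
    refine ⟨C * C', fun n hn => (H n hn).trans (ENNReal.ofReal_le_ofReal ?_)⟩
    have hl := SplitTree.half_le_log hn
    have hl0 : 0 < Real.log n := by linarith
    have h := H' _ hl
    rw [mul_assoc C]
    refine mul_le_mul_of_nonneg_left ?_ hC.le
    rw [neg_mul, Real.exp_neg, ← mul_div_assoc, ← div_eq_mul_inv,
      div_le_div_iff₀ (Real.exp_pos _) (by positivity)]
    nlinarith [mul_le_mul_of_nonneg_left h (Nat.cast_nonneg (α := ℝ) n)]
  · have hl := SplitTree.half_le_log hn
    have hl0 : 0 < Real.log n := by linarith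
    -- The factor one half is needed only for `1 / 2 ≤ log n < 1`, where the power can exceed `log
    -- n`; it turns `B` into `B / 2`.
    have h : Real.log n ^ (2 * ε) / 2 ≤ min (Real.log n ^ (2 * ε)) (Real.log n) := by
      have h0 : 0 < Real.log n ^ (2 * ε) := by positivity
      refine le_min (by linarith) ?_
      rcases le_total 1 (Real.log n) with h1 | h1
      · have := Real.rpow_le_rpow_of_exponent_le h1 (by linarith : 2 * ε ≤ 1)
        rw [Real.rpow_one] at this
        linarith
      · have := Real.rpow_le_one hl0.le h1 (by positivity : 0 ≤ 2 * ε)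
        linarith
    exact ENNReal.ofReal_le_ofReal (mul_le_mul_of_nonneg_left (mul_le_mul_of_nonneg_left
      (Real.exp_le_exp.2 (by nlinarith)) (Nat.cast_nonneg n)) hC.le)
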